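/- Let $L$ be a natural number, let $\Lambda=\{-L+1,\dots,L\}$, let $0<r,\ell<\infty$ and put $q=\sqrt{r/\ell}$. For a configuration $\eta\in\{0,1,2\}^{\Lambda}$ (where $0$ stands for a particle of type $A$, $1$ for a vacant site, $2$ for a particle of type $B$) put $a_k=\delta_{\eta(k),0}$ and $b_k=\delta_{\eta(k),2}$, and let $\mathbb S^{2L}_{N,M}$ be the set of configurations with exactly $N$ particles of type $A$ and $M$ particles of type $B$. Let $[n]_q=\frac{q^n-q^{-n}}{q-q^{-1}}$ (with $[n]_1=n$), $[n]_q!=\prod_{k=1}^n[k]_q$, and for $\eta\in\mathbb S^{2L}_{N,M}$ let $$\pi^*_{N,M}(\eta)=\frac{[N]_q!\,[M]_q!\,[2L-N-M]_q!}{[2L]_q!}\;q^{\sum_{k=-L+1}^{L}(2k-1)(a_k-b_k)+\sum_{k=-L+1}^{L-1}\sum_{l=-L+1}^{k}(a_lb_{k+1}-b_la_{k+1})},$$ with $\pi^*_{N,M}(\eta)=0$ for all other $\eta$. This is the canonical stationary distribution of the two-component asymmetric simple exclusion process, in which nearest neighbours exchange as $A0\to0A$, $0B\to B0$, $AB\to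 BA$ with rate $r$ and as $0A\to A0$, $B0\to0B$, $BA\to AB$ with rate $\ell$ (here $0$ is a vacant site). For a configuration $z$ with $A$-particles at the sites of $\mathbf x$ and $B$-particles at the sites of $\mathbf y$, define $$Q_z(\eta)=\prod_{x\in\mathbf x}q^{\sum_{k<x}a_k-\sum_{k>x}a_k}\,a_x\;\prod_{y\in\mathbf y}q^{-\sum_{k<y}b_k+\sum_{k>y}b_k}\,b_y .$$ Then for all $N,M,N',M'\ge 0$ there is a constant $\lambda_{N,M}^{N',M'}$ (depending on $L$ and $q$, but not on $\eta$ or $z$) such that for all $z\in\mathbb S^{2L}_{N',M'}$ and all $\eta\in\mathbb S^{2L}_{N,M}$ $$\bigl(\pi^*_{N',M'}(z)\bigr)^{-1}\sum_{\eta'\in\mathbb S^{2L}_{N,M}}\pi^*_{N,M}(\eta')\,Q_z(\eta')=\sum_{z'\in\mathbb S^{2L}_{N',M'}}Q_{z'}(\eta)=\lambda_{N,M}^{N',M'},$$ and $\lambda_{N,M}^{N',M'}=0$ if $N'>N$ or $M'>M$. -/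

import Mathlib

namespace TwoASEP

noncomputable section

/-- The lattice `{-L+1, …, L}` of `2L` sites. -/
abbrev Site (L : ℕ) : Type := ↥(Finset.Icc (-(L : ℤ) + 1) (L : ℤ))

/-- Configurations of the two-component exclusion process: `0` is a particle of type `A`,
`1` is a vacant site, `2` is a particle of type `B`. -/
abbrev Config (L : ℕ) : Type := Site L → Fin 3

/-- Asymmetry parameter `q = √(r / ℓ)` for the hopping rates `r` and `ℓ`. -/
def asym (r l : ℝ) : ℝ := Real.sqrt (r / l)

variable {L : ℕ}

/-- Local occupation number of `A`-particles. -/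
def a (η : Config L) (k : Site L) : ℤ := if η k = 0 then 1 else 0

/-- Local occupation number of `B`-particles. -/
def b (η : Config L) (k : Site L) : ℤ := if η k = 2 then 1 else 0

/-- Positions of the `A`-particles. -/
def xPos (η : Config L) : Finset (Site L) := Finset.univ.filter (fun k => η k = 0)

/-- Positions of the `B`-particles. -/
def yPos (η : Config L) : Finset (Site L) := Finset.univ.filter (fun k => η k = 2)

/-- Number of `A`-particles. -/
def numA (η : Config L) : ℕ := (xPos η).card

/-- Number of `B`-particles. -/
def numB (η : Config L) : ℕ := (yPos η).card

/-- The set of configurations with `N` particles of type `A` and `M` particles of type `B`. -/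
def sector (L N M : ℕ) : Finset (Config L) :=
  Finset.univ.filter (fun η => numA η = N ∧ numB η = M)

/-- Symmetric `q`-number `[n]_q`; at `q = 1` it is the limit value `n`. -/
def qNumber (q : ℝ) (n : ℕ) : ℝ :=
  if q = 1 then (n : ℝ) else (q ^ (n : ℤ) - q ^ (-(n : ℤ))) / (q - q⁻¹)

/-- The `q`-factorial `[n]_q! = [1]_q [2]_q ⋯ [n]_q`. -/
def qFactorial (q : ℝ) (n : ℕ) : ℝ := ∏ k ∈ Finset.Icc 1 n, qNumber q k

/-- The `q`-multinomial coefficient `[K]_q! / ([N]_q! [M]_q! [K-N-M]_q!)`, for `N + M ≤ K`. -/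
def qMultinomial (q : ℝ) (K N M : ℕ) : ℝ :=
  qFactorial q K / (qFactorial q N * qFactorial q M * qFactorial q (K - N - M))

/-- The reversible measure (not normalized). In the second sum, the pairs `l < m` are the pairs
`l ≤ k`, `m = k + 1` with `-L + 1 ≤ k ≤ L - 1`. -/
def revMeasure (q : ℝ) (η : Config L) : ℝ :=
  q ^ ((∑ k : Site L, (2 * (k : ℤ) - 1) * (a η k - b η k)) +
    ∑ m : Site L, ∑ l ∈ Finset.univ.filter (fun l : Site L => l < m),
      (a η l * b η m - b η l * a η m))

/-- The canonical stationary distribution on the sector with particle numbers `N` and `M`, with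
normalization factor the `q`-multinomial coefficient. -/
def canonical (q : ℝ) (N M : ℕ) (η : Config L) : ℝ :=
  if η ∈ sector L N M then revMeasure q η / qMultinomial q (2 * L) N M else 0

/-- `Q_x^A(η) = q ^ (∑_{k<x} a_k - ∑_{k>x} a_k) a_x`. -/
def QA (q : ℝ) (x : Site L) (η : Config L) : ℝ :=
  q ^ ((∑ k ∈ Finset.univ.filter (fun k : Site L => k < x), a η k) -
    ∑ k ∈ Finset.univ.filter (fun k : Site L => x < k), a η k) * (a η x : ℝ)

/-- `Q_y^B(η) = q ^ (-∑_{k<y} b_k + ∑_{k>y} b_k) b_y`. -/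
def QB (q : ℝ) (y : Site L) (η : Config L) : ℝ :=
  q ^ (-(∑ k ∈ Finset.univ.filter (fun k : Site L => k < y), b η k) +
    ∑ k ∈ Finset.univ.filter (fun k : Site L => y < k), b η k) * (b η y : ℝ)

/-- The function `Q_z(η)`, the product over the particle positions of `z`. -/
def Q (q : ℝ) (z η : Config L) : ℝ :=
  (∏ x ∈ xPos z, QA q x η) * ∏ y ∈ yPos z, QB q y η

end

end TwoASEP

namespace TwoASEP

open Finset

/-! Everything is expressed through the signed rank of a site x in a set S: elements of S left of x
minus those right of x. If η has A-set A and B-set B, then Q_z(η) vanishes unless X ⊆ A and Y ⊆ B,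
and is then q to the sum of ranks of X in A minus ranks of Y in B. The reversible weight is q to the
ranks of A in the lattice minus ranks of B in the complement of A.

The sum over z' splits into two subset sums, each a symmetric q-binomial coefficient
(`gaussSum_eq`), so it depends on η only through its particle numbers.

The sum over η' is carried by `sum_superset_zpow`: the sum over T ⊇ X inside S is a weight of X
times a q-binomial in S \ X. It is applied to B in the complement of A, then to A in the complement
of Y. Antisymmetry of the rank (`sum_signedRank_swap`) transfers the A–Y interaction between the two
steps and rebuilds the weight of z. The q-factorials then match. -/

/-- Sums over the `k`-element subsets of `S` that contain `X`. -/
theorem sum_powersetCard_superset {α : Type*} [DecidableEq α] {S X : Finset α} (hX : X ⊆ S)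
    (k : ℕ) (f : Finset α → ℝ) :
    ∑ T ∈ S.powersetCard (X.card + k), (if X ⊆ T then f T else 0) =
      ∑ T ∈ (S \ X).powersetCard k, f (X ∪ T) := by
  rw [← sum_filter]
  symm
  refine sum_bij' (fun T _ => X ∪ T) (fun T _ => T \ X) ?_ ?_ ?_ ?_ ?_
  · intro T hT
    obtain ⟨hTS, hc⟩ := mem_powersetCard.1 hT
    refine mem_filter.2 ⟨mem_powersetCard.2 ⟨union_subset hX (hTS.trans sdiff_subset), ?_⟩,
      subset_union_left⟩
    rw [card_union_of_disjoint (disjoint_of_subset_right hTS disjoint_sdiff), hc]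
  · intro T hT
    obtain ⟨hT, hXT⟩ := mem_filter.1 hT
    obtain ⟨hTS, hc⟩ := mem_powersetCard.1 hT
    refine mem_powersetCard.2 ⟨sdiff_subset_sdiff hTS le_rfl, ?_⟩
    rw [card_sdiff_of_subset hXT, hc]
    omega
  · intro T hT
    obtain ⟨hTS, -⟩ := mem_powersetCard.1 hT
    exact union_sdiff_cancel_left (disjoint_of_subset_right hTS disjoint_sdiff)
  · intro T hT
    exact union_sdiff_of_subset (mem_filter.1 hT).2
  · intros; rfl

/-! ### Signed ranks in finite linear orders -/

section Rank

variable {α : Type*} [LinearOrder α]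

/-- The sign of `x - y`, for elements of a linear order. -/
def orderSign (x y : α) : ℤ := (if y < x then 1 else 0) - if x < y then 1 else 0

/-- The number of elements of `S` to the left of `x` minus the number of those to the right. -/
def signedRank (S : Finset α) (x : α) : ℤ := ∑ s ∈ S, orderSign x s

theorem orderSign_swap (x y : α) : orderSign y x = -orderSign x y := by
  unfold orderSign; ring

theorem sum_signedRank_swap (S T : Finset α) :
    ∑ t ∈ T, signedRank S t = -∑ s ∈ S, signedRank T s := by
  unfold signedRank
  rw [sum_comm, ← sum_neg_distrib]
  refine sum_congr rfl fun s _ => ?_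
  rw [← sum_neg_distrib]
  exact sum_congr rfl fun t _ => orderSign_swap _ _

theorem sum_signedRank_self (S : Finset α) : ∑ t ∈ S, signedRank S t = 0 := by
  have := sum_signedRank_swap S S
  omega

theorem signedRank_union [DecidableEq α] {S T : Finset α} (h : Disjoint S T) (x : α) :
    signedRank (S ∪ T) x = signedRank S x + signedRank T x := sum_union h

theorem signedRank_sdiff [DecidableEq α] {S T : Finset α} (h : T ⊆ S) (x : α) :
    signedRank (S \ T) x = signedRank S x - signedRank T x := by
  have := sum_sdiff (f := orderSign x) h
  unfold signedRank
  omega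

theorem signedRank_insert_of_lt {S : Finset α} {m x : α} (hm : m ∉ S) (h : x < m) :
    signedRank (insert m S) x = signedRank S x - 1 := by
  unfold signedRank
  rw [sum_insert hm]
  simp only [orderSign, h, h.not_gt, if_true, if_false]
  ring

theorem signedRank_insert_max {S : Finset α} {m : α} (h : ∀ x ∈ S, x < m) :
    signedRank (insert m S) m = S.card := by
  have hm : m ∉ S := fun hm => lt_irrefl _ (h m hm)
  unfold signedRank
  rw [sum_insert hm, sum_congr rfl (g := fun _ => (1 : ℤ))]
  · simp [orderSign]
  · intro x hx
    simp [orderSign, h x hx, (h x hx).not_gt]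

/-- The `q`-weighted number of `k`-element subsets of `S`. -/
noncomputable def gaussSum (q : ℝ) (S : Finset α) (k : ℕ) : ℝ :=
  ∑ T ∈ S.powersetCard k, q ^ ∑ t ∈ T, signedRank S t

theorem gaussSum_zero (q : ℝ) (S : Finset α) : gaussSum q S 0 = 1 := by
  simp [gaussSum]

theorem gaussSum_of_card_lt (q : ℝ) {S : Finset α} {k : ℕ} (h : S.card < k) :
    gaussSum q S k = 0 := by
  simp [gaussSum, powersetCard_eq_empty.2 h]

theorem sum_signedRank_insert {S T : Finset α} {m : α} (h : ∀ x ∈ S, x < m) (hT : T ⊆ S) :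
    ∑ t ∈ T, signedRank (insert m S) t = ∑ t ∈ T, signedRank S t - T.card := by
  have hm : m ∉ S := fun hm => lt_irrefl _ (h m hm)
  rw [sum_congr rfl fun t ht => signedRank_insert_of_lt hm (h t (hT ht))]
  simp

/-- The `q`-Pascal recursion. -/
theorem gaussSum_insert {q : ℝ} (hq : q ≠ 0) {S : Finset α} {m : α} (h : ∀ x ∈ S, x < m)
    (k : ℕ) :
    gaussSum q (insert m S) (k + 1) =
      q ^ (-((k : ℤ) + 1)) * gaussSum q S (k + 1) +
        q ^ ((S.card : ℤ) - k) * gaussSum q S k := by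
  have hm : m ∉ S := fun hm => lt_irrefl _ (h m hm)
  have hmT {T : Finset α} (hT : T ⊆ S) : m ∉ T := fun h' => hm (hT h')
  unfold gaussSum
  rw [powersetCard_succ_insert hm, sum_union, sum_image, mul_sum, mul_sum]
  · congr 1
    · refine sum_congr rfl fun T hT => ?_
      obtain ⟨hTS, hc⟩ := mem_powersetCard.1 hT
      rw [sum_signedRank_insert h hTS, hc, ← zpow_add₀ hq]
      congr 1
      push_cast
      ring
    · refine sum_congr rfl fun T hT => ?_
      obtain ⟨hTS, hc⟩ := mem_powersetCard.1 hT
      rw [sum_insert (hmT hTS), sum_signedRank_insert h hTS, signedRank_insert_max h, hc,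
        ← zpow_add₀ hq]
      congr 1
      ring
  · intro T hT T' hT' he
    have h1 := hmT (mem_powersetCard.1 hT).1
    have h2 := hmT (mem_powersetCard.1 hT').1
    rw [← erase_insert h1, ← erase_insert h2, he]
  · rw [disjoint_left]
    intro T hT hT'
    obtain ⟨T', -, rfl⟩ := mem_image.1 hT'
    exact hm ((mem_powersetCard.1 hT).1 (mem_insert_self _ _))

/-- Write T as X ∪ T' with T' disjoint from X. Ranks of X in itself cancel, and ranks of X in T' are
minus those of T' in X, which turns ranks of T' in S into ranks in S \ X. -/
theorem sum_superset_zpow [DecidableEq α] {q : ℝ} (hq : q ≠ 0) {S X : Finset α} (hX : X ⊆ S) (k : ℕ) :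
    ∑ T ∈ S.powersetCard (X.card + k),
        (if X ⊆ T then q ^ (∑ t ∈ T, signedRank S t + ∑ x ∈ X, signedRank T x) else 0) =
      q ^ (∑ x ∈ X, signedRank S x) * gaussSum q (S \ X) k := by
  rw [sum_powersetCard_superset hX, gaussSum, mul_sum]
  refine sum_congr rfl fun T hT => ?_
  have hd : Disjoint X T :=
    disjoint_of_subset_right (mem_powersetCard.1 hT).1 disjoint_sdiff
  rw [← zpow_add₀ hq, sum_union hd, sum_congr rfl fun x _ => signedRank_union hd x,
    sum_add_distrib, sum_signedRank_self, sum_signedRank_swap T X,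
    sum_congr (s₁ := T) (g := fun t => signedRank S t - signedRank X t) rfl
      fun t _ => signedRank_sdiff hX t, sum_sub_distrib]
  congr 1
  ring

end Rank

/-! ### Quantum numbers -/

theorem sub_inv_ne_zero {q : ℝ} (hq : 0 < q) (h1 : q ≠ 1) : q - q⁻¹ ≠ 0 := by
  intro h
  have h2 : q * q = 1 := by
    field_simp at h
    nlinarith
  exact h1 (by nlinarith)

/-- With these weights the recursion of `gaussSum_insert` is the one satisfied by quotients of
q-factorials. -/
theorem qNumber_add {q : ℝ} (hq : 0 < q) (i j : ℕ) :
    qNumber q (i + j) = q ^ (-(j : ℤ)) * qNumber q i + q ^ (i : ℤ) * qNumber q j := by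
  unfold qNumber
  split_ifs with h
  · simp [h]
  · have := sub_inv_ne_zero hq h
    have h1 : q ^ ((i + j : ℕ) : ℤ) = q ^ (i : ℤ) * q ^ (j : ℤ) := by
      rw [← zpow_add₀ hq.ne']; simp
    have h2 : q ^ (-((i + j : ℕ) : ℤ)) = q ^ (-(i : ℤ)) * q ^ (-(j : ℤ)) := by
      rw [← zpow_add₀ hq.ne']; congr 1; push_cast; ring
    rw [h1, h2]
    ring

theorem qNumber_zero (q : ℝ) : qNumber q 0 = 0 := by simp [qNumber]

theorem qNumber_one {q : ℝ} (hq : 0 < q) : qNumber q 1 = 1 := by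
  unfold qNumber
  split_ifs with h
  · simp
  · simpa using div_self (sub_inv_ne_zero hq h)

theorem qNumber_succ_pos {q : ℝ} (hq : 0 < q) (n : ℕ) : 0 < qNumber q (n + 1) := by
  induction n with
  | zero => rw [zero_add, qNumber_one hq]; exact one_pos
  | succ n ih =>
    rw [qNumber_add hq, qNumber_one hq]
    positivity

/-- B-particles carry base q⁻¹; this invariance gives them the same q-binomials as the A-particles.
-/
theorem qNumber_inv (q : ℝ) (n : ℕ) : qNumber q⁻¹ n = qNumber q n := by
  unfold qNumber
  by_cases h : q = 1
  · simp [h]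
  · rw [if_neg h, if_neg (by simpa using h), inv_inv, inv_zpow', inv_zpow', neg_neg,
      ← neg_sub (q ^ (n : ℤ)), ← neg_sub q, neg_div_neg_eq]

theorem qFactorial_inv (q : ℝ) (n : ℕ) : qFactorial q⁻¹ n = qFactorial q n := by
  simp [qFactorial, qNumber_inv]

theorem qFactorial_zero (q : ℝ) : qFactorial q 0 = 1 := by simp [qFactorial]

theorem qFactorial_succ (q : ℝ) (n : ℕ) :
    qFactorial q (n + 1) = qFactorial q n * qNumber q (n + 1) := by
  unfold qFactorial
  rw [prod_Icc_succ_top (by omega)]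

theorem qFactorial_pos {q : ℝ} (hq : 0 < q) (n : ℕ) : 0 < qFactorial q n := by
  induction n with
  | zero => rw [qFactorial_zero]; exact one_pos
  | succ n ih =>
    rw [qFactorial_succ]
    exact mul_pos ih (qNumber_succ_pos hq n)

/-- The `q`-binomial theorem for subset sums. -/
theorem gaussSum_mul_qFactorial {α : Type*} [LinearOrder α] {q : ℝ} (hq : 0 < q)
    (S : Finset α) :
    ∀ i j : ℕ, S.card = i + j →
      gaussSum q S j * (qFactorial q j * qFactorial q i) = qFactorial q (i + j) := by
  induction S using Finset.induction_on_max with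
  | empty =>
    intro i j h
    obtain ⟨rfl, rfl⟩ : i = 0 ∧ j = 0 := by simpa [eq_comm] using h
    simp [gaussSum_zero, qFactorial_zero]
  | insert m S h ih =>
    have hm : m ∉ S := fun hm => lt_irrefl _ (h m hm)
    intro i j hc
    rw [card_insert_of_notMem hm] at hc
    cases j with
    | zero => simp [gaussSum_zero, qFactorial_zero]
    | succ j =>
      have hS : S.card = i + j := by omega
      have h2 := ih i j hS
      have he : ((S.card : ℤ) - j) = i := by rw [hS]; push_cast; ring
      -- The term of the recursion that omits `m`. For i = 0 both sides vanish; otherwise the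
      -- induction hypothesis applies at (i - 1, j + 1).
      have h1 : gaussSum q S (j + 1) * (qFactorial q (j + 1) * qFactorial q i) =
          qFactorial q (i + j) * qNumber q i := by
        cases i with
        | zero => rw [gaussSum_of_card_lt q (by omega), qNumber_zero]; ring
        | succ i =>
          have h3 := ih i (j + 1) (by omega)
          rw [show i + 1 + j = i + (j + 1) by ring, ← h3, qFactorial_succ q i]
          ring
      rw [gaussSum_insert hq.ne' h, he, ← add_assoc, qFactorial_succ q (i + j), add_assoc i j 1,
        qNumber_add hq i (j + 1)]
      calc _ = q ^ (-((j : ℤ) + 1)) *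
              (gaussSum q S (j + 1) * (qFactorial q (j + 1) * qFactorial q i)) +
            q ^ (i : ℤ) * (gaussSum q S j * (qFactorial q j * qFactorial q i)) *
              qNumber q (j + 1) := by rw [qFactorial_succ q j]; ring
        _ = _ := by rw [h1, h2]; push_cast; ring

theorem gaussSum_eq {α : Type*} [LinearOrder α] {q : ℝ} (hq : 0 < q) {S : Finset α}
    {i j : ℕ} (h : S.card = i + j) :
    gaussSum q S j = qFactorial q (i + j) / (qFactorial q j * qFactorial q i) := by
  have h1 := qFactorial_pos hq i
  have h2 := qFactorial_pos hq j
  rw [eq_div_iff (by positivity)]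
  exact gaussSum_mul_qFactorial hq S i j h

theorem gaussSum_inv_eq {α : Type*} [LinearOrder α] {q : ℝ} (hq : 0 < q) {S : Finset α}
    {i j : ℕ} (h : S.card = i + j) :
    gaussSum q⁻¹ S j = qFactorial q (i + j) / (qFactorial q j * qFactorial q i) := by
  rw [gaussSum_eq (inv_pos.2 hq) h]
  simp only [qFactorial_inv]

/-! ### Configurations as pairs of disjoint sets -/

variable {L : ℕ}

theorem mem_xPos {η : Config L} {k : Site L} : k ∈ xPos η ↔ η k = 0 := by simp [xPos]

theorem mem_yPos {η : Config L} {k : Site L} : k ∈ yPos η ↔ η k = 2 := by simp [yPos]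

theorem disjoint_xPos_yPos (η : Config L) : Disjoint (xPos η) (yPos η) := by
  rw [disjoint_left]
  intro k h h'
  rw [mem_xPos] at h
  rw [mem_yPos, h] at h'
  exact absurd h' (by decide)

theorem mem_sector {N M : ℕ} {η : Config L} :
    η ∈ sector L N M ↔ (xPos η).card = N ∧ (yPos η).card = M := by
  rw [sector, mem_filter, numA, numB]
  simp only [mem_univ, true_and]

/-- The configuration with given positions of the particles. -/
def ofPos (A B : Finset (Site L)) : Config L :=
  fun k => if k ∈ A then 0 else if k ∈ B then 2 else 1

theorem xPos_ofPos (A B : Finset (Site L)) : xPos (ofPos A B) = A := by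
  ext k
  rw [mem_xPos, ofPos]
  split_ifs <;> simp_all

theorem yPos_ofPos {A B : Finset (Site L)} (h : Disjoint A B) : yPos (ofPos A B) = B := by
  ext k
  have : k ∈ A → k ∉ B := fun hA => disjoint_left.1 h hA
  rw [mem_yPos, ofPos]
  split_ifs <;> simp_all

theorem ofPos_pos (η : Config L) : ofPos (xPos η) (yPos η) = η := by
  funext k
  simp only [ofPos, mem_xPos, mem_yPos]
  generalize η k = t
  revert t
  decide

theorem sum_sector (N M : ℕ) (f : Finset (Site L) → Finset (Site L) → ℝ) :
    ∑ η ∈ sector L N M, f (xPos η) (yPos η) =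
      ∑ A ∈ powersetCard N univ, ∑ B ∈ powersetCard M (univ \ A), f A B := by
  rw [sum_sigma']
  refine sum_bij' (fun η _ => ⟨xPos η, yPos η⟩) (fun p _ => ofPos p.1 p.2) ?_ ?_ ?_ ?_ ?_
  · intro η h
    obtain ⟨h1, h2⟩ := mem_sector.1 h
    refine mem_sigma.2 ⟨mem_powersetCard.2 ⟨subset_univ _, h1⟩, mem_powersetCard.2 ⟨?_, h2⟩⟩
    exact subset_sdiff.2 ⟨subset_univ _, (disjoint_xPos_yPos η).symm⟩
  · rintro ⟨A, B⟩ h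
    obtain ⟨h1, h2⟩ := mem_sigma.1 h
    obtain ⟨h3, h4⟩ := mem_powersetCard.1 h2
    rw [mem_sector, xPos_ofPos, yPos_ofPos (subset_sdiff.1 h3).2.symm]
    exact ⟨(mem_powersetCard.1 h1).2, h4⟩
  · intro η _
    exact ofPos_pos η
  · rintro ⟨A, B⟩ h
    obtain ⟨h3, -⟩ := mem_powersetCard.1 (mem_sigma.1 h).2
    simp only [xPos_ofPos, yPos_ofPos (subset_sdiff.1 h3).2.symm]
  · intros; rfl

/-! ### `Q` and the reversible measure in terms of signed ranks -/

theorem a_eq (η : Config L) (k : Site L) : a η k = if k ∈ xPos η then 1 else 0 := by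
  simp [a, mem_xPos]

theorem b_eq (η : Config L) (k : Site L) : b η k = if k ∈ yPos η then 1 else 0 := by
  simp [b, mem_yPos]

theorem sum_lt_sub_sum_gt (S : Finset (Site L)) (x : Site L) :
    (∑ k ∈ univ.filter (fun k : Site L => k < x), if k ∈ S then (1 : ℤ) else 0) -
      ∑ k ∈ univ.filter (fun k : Site L => x < k), (if k ∈ S then (1 : ℤ) else 0) =
      signedRank S x := by
  rw [sum_filter, sum_filter, ← sum_sub_distrib, signedRank,
    ← sum_subset (subset_univ S) (f := fun k => (if k < x then if k ∈ S then (1 : ℤ) else 0 else 0)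
      - if x < k then if k ∈ S then (1 : ℤ) else 0 else 0) (fun k _ hk => by simp [hk])]
  exact sum_congr rfl fun k hk => by simp [hk, orderSign]

theorem QA_eq (q : ℝ) (x : Site L) (η : Config L) :
    QA q x η = if x ∈ xPos η then q ^ signedRank (xPos η) x else 0 := by
  unfold QA
  simp only [a_eq]
  rw [sum_lt_sub_sum_gt]
  split_ifs <;> simp

theorem QB_eq (q : ℝ) (y : Site L) (η : Config L) :
    QB q y η = if y ∈ yPos η then q⁻¹ ^ signedRank (yPos η) y else 0 := by
  unfold QB
  simp only [b_eq]
  rw [inv_zpow', ← sum_lt_sub_sum_gt, neg_sub, neg_add_eq_sub]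
  split_ifs <;> simp

theorem prod_ite_zpow {α : Type*} [DecidableEq α] {q : ℝ} (hq : q ≠ 0) (X A : Finset α)
    (f : α → ℤ) :
    ∏ x ∈ X, (if x ∈ A then q ^ f x else 0) = if X ⊆ A then q ^ ∑ x ∈ X, f x else 0 := by
  split_ifs with h
  · rw [prod_congr rfl fun x hx => if_pos (h hx)]
    induction X using Finset.induction_on with
    | empty => simp
    | insert x X hx ih =>
      rw [prod_insert hx, sum_insert hx, zpow_add₀ hq,
        ih ((subset_insert _ _).trans h)]
  · obtain ⟨x, hx, hxA⟩ := not_subset.1 h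
    exact prod_eq_zero hx (if_neg hxA)

theorem Q_eq {q : ℝ} (hq : q ≠ 0) (z η : Config L) :
    Q q z η =
      (if xPos z ⊆ xPos η then q ^ ∑ x ∈ xPos z, signedRank (xPos η) x else 0) *
        if yPos z ⊆ yPos η then q⁻¹ ^ ∑ y ∈ yPos z, signedRank (yPos η) y else 0 := by
  unfold Q
  simp only [QA_eq, QB_eq]
  rw [prod_ite_zpow hq, prod_ite_zpow (inv_ne_zero hq)]

/-- There are x + L - 1 sites to the left of x and L - x to the right. -/
theorem signedRank_univ (x : Site L) : signedRank univ x = 2 * (x : ℤ) - 1 := by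
  have hx := mem_Icc.1 x.2
  have h : signedRank univ x =
      ∑ k ∈ Icc (-(L : ℤ) + 1) (L : ℤ), orderSign (x : ℤ) k := by
    rw [← sum_coe_sort]
    rfl
  rw [h]
  simp only [orderSign, sum_sub_distrib, sum_boole]
  rw [show (Icc (-(L : ℤ) + 1) (L : ℤ)).filter (fun k => k < (x : ℤ)) =
      Ico (-(L : ℤ) + 1) x by ext k; simp only [mem_filter, mem_Icc, mem_Ico]; omega,
    show (Icc (-(L : ℤ) + 1) (L : ℤ)).filter (fun k => (x : ℤ) < k) =
      Ioc (x : ℤ) L by ext k; simp only [mem_filter, mem_Icc, mem_Ioc]; omega]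
  simp only [Int.card_Ico, Int.card_Ioc]
  omega

theorem sum_cross (A B : Finset (Site L)) :
    ∑ m : Site L, ∑ l ∈ univ.filter (fun l : Site L => l < m),
      (((if l ∈ A then 1 else 0) * if m ∈ B then 1 else 0) -
        (if l ∈ B then 1 else 0) * if m ∈ A then (1 : ℤ) else 0) =
      ∑ y ∈ B, signedRank A y := by
  have h1 : ∑ y ∈ B, signedRank A y = ∑ m : Site L, ∑ l : Site L,
      ((if l < m then (if l ∈ A then 1 else 0) * (if m ∈ B then 1 else 0) else 0) -
        if m < l then (if l ∈ A then 1 else 0) * (if m ∈ B then (1 : ℤ) else 0) else 0) := by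
    rw [← sum_subset (subset_univ B) (by intro m _ hm; simp [hm])]
    refine sum_congr rfl fun m hm => ?_
    rw [signedRank, ← sum_subset (subset_univ A) (by intro l _ hl; simp [hl])]
    exact sum_congr rfl fun l hl => by simp [hl, hm, orderSign]
  rw [h1]
  simp only [sum_filter, sum_sub_distrib]
  congr 1
  rw [sum_comm]
  exact sum_congr rfl fun m _ => sum_congr rfl fun l _ => by rw [mul_comm]

/-- The A–B interaction is the sum of ranks of the B-sites in A, so it only removes the A-sites from
the lattice in which B is ranked. -/
theorem revMeasure_eq {q : ℝ} (hq : q ≠ 0) (η : Config L) :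
    revMeasure q η =
      q ^ (∑ x ∈ xPos η, signedRank univ x) *
        q⁻¹ ^ (∑ y ∈ yPos η, signedRank (univ \ xPos η) y) := by
  unfold revMeasure
  simp only [a_eq, b_eq]
  rw [sum_cross, inv_zpow', ← zpow_add₀ hq]
  congr 1
  simp only [signedRank_sdiff (subset_univ _), sum_sub_distrib, mul_sub, mul_ite, mul_one, mul_zero,
    sum_ite_mem, univ_inter, signedRank_univ]
  ring

theorem card_site : (univ : Finset (Site L)).card = 2 * L := by
  simp only [univ_eq_attach, card_attach, Int.card_Icc]
  omega

/-! ### Evaluation of the two sums -/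

/-- The sum factorizes because subsets of `xPos η` and `yPos η` are automatically disjoint, so the
exclusion constraint on z is void. -/
theorem sum_Q_eq {q : ℝ} (hq : q ≠ 0) (N' M' : ℕ) (η : Config L) :
    ∑ z ∈ sector L N' M', Q q z η = gaussSum q (xPos η) N' * gaussSum q⁻¹ (yPos η) M' := by
  simp only [Q_eq hq]
  rw [sum_sector N' M' fun X Y =>
    (if X ⊆ xPos η then q ^ ∑ x ∈ X, signedRank (xPos η) x else 0) *
      if Y ⊆ yPos η then q⁻¹ ^ ∑ y ∈ Y, signedRank (yPos η) y else 0]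
  rw [gaussSum, sum_mul, ← sum_subset (powersetCard_mono (subset_univ (xPos η)))]
  · refine sum_congr rfl fun X hX => ?_
    obtain ⟨hX, hc⟩ := mem_powersetCard.1 hX
    rw [if_pos hX, ← mul_sum, gaussSum]
    congr 1
    rw [← sum_subset (s₁ := powersetCard M' (yPos η))]
    · exact sum_congr rfl fun Y hY => if_pos (mem_powersetCard.1 hY).1
    · exact powersetCard_mono (subset_sdiff.2 ⟨subset_univ _,
        (disjoint_of_subset_left hX (disjoint_xPos_yPos η)).symm⟩)
    · intro Y hY hY'
      exact if_neg fun h => hY' (mem_powersetCard.2 ⟨h, (mem_powersetCard.1 hY).2⟩)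
  · intro X hX hX'
    have : ¬ X ⊆ xPos η := fun h => hX' (mem_powersetCard.2 ⟨h, (mem_powersetCard.1 hX).2⟩)
    simp [this]

/-- Here c and d count the particles of η beyond those of z, and p counts its vacant sites. -/
theorem sum_revMeasure_mul_Q {q : ℝ} (hq : 0 < q) (z : Config L) (c d p : ℕ)
    (hL : 2 * L = (numA z + c) + (numB z + d) + p) :
    ∑ η ∈ sector L (numA z + c) (numB z + d), revMeasure q η * Q q z η =
      revMeasure q z *
        (qFactorial q (c + d + p) / (qFactorial q c * qFactorial q d * qFactorial q p)) := by
  have hq0 := hq.ne'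
  have hqi := inv_ne_zero hq0
  set X := xPos z with hX
  set Y := yPos z with hY
  have hXY : Disjoint X Y := disjoint_xPos_yPos z
  have hcX : X.card = numA z := rfl
  have hcY : Y.card = numB z := rfl
  have hf (A B : Finset (Site L)) :
      q ^ (∑ x ∈ A, signedRank univ x) * q⁻¹ ^ (∑ y ∈ B, signedRank (univ \ A) y) *
        ((if X ⊆ A then q ^ ∑ x ∈ X, signedRank A x else 0) *
          if Y ⊆ B then q⁻¹ ^ ∑ y ∈ Y, signedRank B y else 0) =
      (if X ⊆ A then q ^ (∑ x ∈ A, signedRank univ x + ∑ x ∈ X, signedRank A x) else 0) *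
        if Y ⊆ B then q⁻¹ ^ (∑ y ∈ B, signedRank (univ \ A) y + ∑ y ∈ Y, signedRank B y)
          else 0 := by
    rw [zpow_add₀ hq0, zpow_add₀ hqi]
    split_ifs <;> ring
  simp only [Q_eq hq0, revMeasure_eq hq0, ← hX, ← hY]
  rw [sum_sector _ _ fun A B =>
    q ^ (∑ x ∈ A, signedRank univ x) * q⁻¹ ^ (∑ y ∈ B, signedRank (univ \ A) y) *
        ((if X ⊆ A then q ^ ∑ x ∈ X, signedRank A x else 0) *
          if Y ⊆ B then q⁻¹ ^ ∑ y ∈ Y, signedRank B y else 0)]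
  simp only [hf, ← mul_sum]
  -- If A meets Y, no B in the complement of A contains Y, so only A disjoint from Y contribute.
  rw [← sum_subset (powersetCard_mono (subset_univ (univ \ Y)))]
  · have inner : ∀ A ∈ powersetCard (numA z + c) (univ \ Y),
        (if X ⊆ A then q ^ (∑ x ∈ A, signedRank univ x + ∑ x ∈ X, signedRank A x) else 0) *
          (∑ B ∈ powersetCard (numB z + d) (univ \ A), if Y ⊆ B then
            q⁻¹ ^ (∑ y ∈ B, signedRank (univ \ A) y + ∑ y ∈ Y, signedRank B y) else 0) =
        (if X ⊆ A then q ^ (∑ x ∈ A, signedRank (univ \ Y) x + ∑ x ∈ X, signedRank A x) else 0) *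
          (q ^ (-∑ y ∈ Y, signedRank univ y) *
            (qFactorial q (p + d) / (qFactorial q d * qFactorial q p))) := by
      intro A hA
      obtain ⟨hAY, hcA⟩ := mem_powersetCard.1 hA
      have hd : Disjoint A Y := (subset_sdiff.1 hAY).2
      have hYA : Y ⊆ univ \ A := subset_sdiff.2 ⟨subset_univ _, hd.symm⟩
      have hcard : ((univ \ A) \ Y).card = p + d := by
        rw [card_sdiff_of_subset hYA, card_sdiff_of_subset (subset_univ _), card_site]
        omega
      rw [← hcY, sum_superset_zpow hqi hYA, gaussSum_inv_eq hq hcard]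
      split_ifs with h
      · rw [← mul_assoc, ← mul_assoc]
        congr 1
        -- Ranks of Y in A become minus the ranks of A in Y, so A is now ranked in the complement of
        -- Y.
        rw [inv_zpow', ← zpow_add₀ hq0, ← zpow_add₀ hq0]
        congr 1
        simp only [signedRank_sdiff (subset_univ _), sum_sub_distrib]
        rw [sum_signedRank_swap A Y]
        ring
      · ring
    rw [sum_congr rfl inner, ← sum_mul, ← hcX,
      sum_superset_zpow hq0 (subset_sdiff.2 ⟨subset_univ _, hXY⟩)]
    have hcard : ((univ \ Y) \ X).card = (p + d) + c := by
      rw [card_sdiff_of_subset (subset_sdiff.2 ⟨subset_univ _, hXY⟩),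
        card_sdiff_of_subset (subset_univ _), card_site]
      omega
    rw [gaussSum_eq hq hcard, inv_zpow']
    -- The same exchange, between X and Y, recovers the reversible weight of z.
    have hw : q ^ (∑ x ∈ X, signedRank (univ \ Y) x) * q ^ (-∑ y ∈ Y, signedRank univ y) =
        q ^ (∑ x ∈ X, signedRank univ x) * q ^ (-∑ y ∈ Y, signedRank (univ \ X) y) := by
      rw [← zpow_add₀ hq0, ← zpow_add₀ hq0]
      congr 1
      simp only [signedRank_sdiff (subset_univ _), sum_sub_distrib]
      rw [sum_signedRank_swap X Y]
      ring
    rw [← hw, show c + d + p = p + d + c by ring]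
    have h1 := (qFactorial_pos hq (p + d)).ne'
    have h2 := (qFactorial_pos hq c).ne'
    have h3 := (qFactorial_pos hq d).ne'
    have h4 := (qFactorial_pos hq p).ne'
    field_simp
  · intro A hA hA'
    refine mul_eq_zero_of_right _ (sum_eq_zero fun B hB => ?_)
    refine if_neg fun hYB => hA' (mem_powersetCard.2 ⟨subset_sdiff.2 ⟨subset_univ _, ?_⟩,
      (mem_powersetCard.1 hA).2⟩)
    exact (subset_sdiff.1 (hYB.trans (mem_powersetCard.1 hB).1)).2.symm

theorem sum_revMeasure_mul_Q_eq_zero {q : ℝ} (hq : q ≠ 0) (z : Config L) {N M : ℕ}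
    (h : N < numA z ∨ M < numB z) :
    ∑ η ∈ sector L N M, revMeasure q η * Q q z η = 0 := by
  refine sum_eq_zero fun η hη => ?_
  obtain ⟨h1, h2⟩ := mem_sector.1 hη
  rw [Q_eq hq]
  rcases h with h | h
  · have : ¬ xPos z ⊆ xPos η := fun hs => by
      have := card_le_card hs
      unfold numA at h
      omega
    simp [this]
  · have : ¬ yPos z ⊆ yPos η := fun hs => by
      have := card_le_card hs
      unfold numB at h
      omega
    simp [this]

theorem numA_add_numB_le (η : Config L) : numA η + numB η ≤ 2 * L := by
  rw [numA, numB, ← card_union_of_disjoint (disjoint_xPos_yPos η), ← card_site]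
  exact card_le_card (subset_univ _)

theorem revMeasure_pos {q : ℝ} (hq : 0 < q) (η : Config L) : 0 < revMeasure q η :=
  zpow_pos hq _

theorem sum_canonical_mul_Q (q : ℝ) (N M : ℕ) (z : Config L) :
    ∑ η ∈ sector L N M, canonical q N M η * Q q z η =
      (∑ η ∈ sector L N M, revMeasure q η * Q q z η) / qMultinomial q (2 * L) N M := by
  rw [sum_div]
  refine sum_congr rfl fun η hη => ?_
  rw [canonical, if_pos hη]
  ring

end TwoASEP

theorem theorem3 (L : ℕ) (r l : ℝ) (hr : 0 < r) (hl : 0 < l) (N M N' M' : ℕ) :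
    ∃ lam : ℝ,
      (∀ z ∈ TwoASEP.sector L N' M', ∀ η ∈ TwoASEP.sector L N M,
        (TwoASEP.canonical (TwoASEP.asym r l) N' M' z)⁻¹ *
            ∑ η' ∈ TwoASEP.sector L N M,
              TwoASEP.canonical (TwoASEP.asym r l) N M η' * TwoASEP.Q (TwoASEP.asym r l) z η'
          = ∑ z' ∈ TwoASEP.sector L N' M', TwoASEP.Q (TwoASEP.asym r l) z' η ∧
        ∑ z' ∈ TwoASEP.sector L N' M', TwoASEP.Q (TwoASEP.asym r l) z' η = lam) ∧
      (N < N' ∨ M < M' → lam = 0) := by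
  open TwoASEP in
  have hq : 0 < asym r l := Real.sqrt_pos.2 (div_pos hr hl)
  generalize asym r l = q at hq
  by_cases h : N < N' ∨ M < M'
  · refine ⟨0, fun z hz η hη => ?_, fun _ => rfl⟩
    have h0 : ∑ z' ∈ sector L N' M', Q q z' η = 0 := by
      obtain ⟨h1, h2⟩ := mem_sector.1 hη
      rw [sum_Q_eq hq.ne']
      rcases h with h | h
      · rw [gaussSum_of_card_lt q (h1.trans_lt h), zero_mul]
      · rw [gaussSum_of_card_lt _ (h2.trans_lt h), mul_zero]
    obtain ⟨h1, h2⟩ := mem_sector.1 hz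
    refine ⟨?_, h0⟩
    rw [h0, sum_canonical_mul_Q, sum_revMeasure_mul_Q_eq_zero hq.ne' z, zero_div, mul_zero]
    rw [numA, numB, h1, h2]
    exact h
  · obtain ⟨hN, hM⟩ := not_or.1 h
    obtain ⟨c, rfl⟩ := Nat.exists_eq_add_of_le (not_lt.1 hN)
    obtain ⟨d, rfl⟩ := Nat.exists_eq_add_of_le (not_lt.1 hM)
    refine ⟨qFactorial q (c + N') / (qFactorial q N' * qFactorial q c) *
      (qFactorial q (d + M') / (qFactorial q M' * qFactorial q d)), fun z hz η hη => ?_,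
      fun h' => absurd h' h⟩
    have h0 : ∑ z' ∈ sector L N' M', Q q z' η =
        qFactorial q (c + N') / (qFactorial q N' * qFactorial q c) *
          (qFactorial q (d + M') / (qFactorial q M' * qFactorial q d)) := by
      obtain ⟨h1, h2⟩ := mem_sector.1 hη
      rw [sum_Q_eq hq.ne', gaussSum_eq hq (h1.trans (add_comm _ _)),
        gaussSum_inv_eq hq (h2.trans (add_comm _ _))]
    refine ⟨?_, h0⟩
    rw [h0, sum_canonical_mul_Q]
    have hz' := mem_sector.1 hz
    -- The existence of η keeps the truncated subtraction in `qMultinomial` honest and provides the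
    -- vacancy number p.
    have hle := numA_add_numB_le η
    obtain ⟨hη1, hη2⟩ := mem_sector.1 hη
    rw [numA, numB, hη1, hη2] at hle
    obtain ⟨p, hp⟩ := Nat.exists_eq_add_of_le hle
    obtain ⟨rfl, rfl⟩ : numA z = N' ∧ numB z = M' := hz'
    rw [sum_revMeasure_mul_Q hq z c d p hp, canonical, if_pos hz]
    generalize numA z = N' at *
    generalize numB z = M' at *
    unfold qMultinomial
    rw [hp, show N' + c + (M' + d) + p - N' - M' = c + d + p by omega,
      show N' + c + (M' + d) + p - (N' + c) - (M' + d) = p by omega, add_comm c N',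
      add_comm d M']
    have h1 (n : ℕ) := (qFactorial_pos hq n).ne'
    have h2 := (revMeasure_pos hq z).ne'
    have := h1 N'; have := h1 M'; have := h1 c; have := h1 d; have := h1 p
    have := h1 (c + d + p); have := h1 (N' + c); have := h1 (M' + d)
    have := h1 (N' + c + (M' + d) + p)
    -- The factors [c+d+p]!, [p]! and [2L]! cancel, leaving the product of the two q-binomials.
    field_simp
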